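/- Let $\mathcal H$ be a complex Hilbert space and let $T,T'$ be contractions on $\mathcal H$, that is, bounded linear operators with $\|T\|\le 1$ and $\|T'\|\le 1$. Write $D_{T'}=(I-T'^*T')^{1/2}$ for the defect operator of $T'$ and $\mathbb D=\{\lambda\in\mathbb C:|\lambda|<1\}$. We say that $T$ is Harnack dominated by $T'$ if there is a constant $a\ge 1$ such that $$\operatorname{Re}p(T)\le a\,\operatorname{Re}p(T')$$ for every complex polynomial $p$ with $\operatorname{Re}p(z)\ge 0$ for all $|z|\le 1$; here $\operatorname{Re}A=\frac12(A+A^*)$, and $A\le B$ means that $B-A$ is a positive semidefinite operator. (i) If $T$ is Harnack dominated by $T'$, then there is a constant $c>0$ such that $$\|(I-\lambda T)^{-1}(T-T')h\|^2\le \frac{c}{1-|\lambda|^2}\,\|D_{T'}h\|^2\qquad\text{for all } h\in\mathcal H \text{ and all } \lambda\in\mathbb D. \tag{1}$$ (ii) Conversely, if $T$ is an isometry and there is a constant $c>0$ for which (1) holds, then $T$ is Harnack dominated by $T'$. -/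

import Mathlib

open scoped ComplexStarModule

/-- The defect operator `D_T = (I - T* T)^{1/2}` (positive square root) of a contraction `T`. -/
noncomputable def defectOperator {H : Type*} [NormedAddCommGroup H] [InnerProductSpace ℂ H]
    [CompleteSpace H] (T : H →L[ℂ] H) : H →L[ℂ] H :=
  CFC.sqrt (1 - ContinuousLinearMap.adjoint T * T)

/-- `T` is Harnack dominated by `T'` with constant `c`: for every complex polynomial `p` with
`Re p(z) ≥ 0` on the closed unit disc, `Re p(T) ≤ c Re p(T')` in the order of positive operators,
where `Re A = (A + A*) / 2`. -/
def HarnackDominatedWith {H : Type*} [NormedAddCommGroup H] [InnerProductSpace ℂ H]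
    [CompleteSpace H] (c : ℝ) (T T' : H →L[ℂ] H) : Prop :=
  ∀ p : Polynomial ℂ, (∀ z : ℂ, ‖z‖ ≤ 1 → 0 ≤ (p.eval z).re) →
    (ℜ (Polynomial.aeval T p) : H →L[ℂ] H) ≤ c • (ℜ (Polynomial.aeval T' p) : H →L[ℂ] H)

/-- `T` is Harnack dominated by `T'`: this holds with some constant `c ≥ 1`. -/
def HarnackDominated {H : Type*} [NormedAddCommGroup H] [InnerProductSpace ℂ H]
    [CompleteSpace H] (T T' : H →L[ℂ] H) : Prop :=
  ∃ c : ℝ, 1 ≤ c ∧ HarnackDominatedWith c T T'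

/-- The resolvent estimate with constant `c`. For `‖T‖ ≤ 1` and `‖l‖ < 1` the operator `1 - l • T`
is invertible, so that `Ring.inverse` is its inverse. -/
def ResolventEstimate {H : Type*} [NormedAddCommGroup H] [InnerProductSpace ℂ H]
    [CompleteSpace H] (c : ℝ) (T T' : H →L[ℂ] H) : Prop :=
  ∀ (h : H) (l : ℂ), ‖l‖ < 1 →
    ‖Ring.inverse (1 - l • T) ((T - T') h)‖ ^ 2 ≤ c / (1 - ‖l‖ ^ 2) * ‖defectOperator T' h‖ ^ 2

/-! Both directions go through Poisson kernels: Harnack domination with constant `c` holds iff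
`poissonForm (z • T) ≤ c * poissonForm (z • T')` for all `‖z‖ < 1`
(`harnackDominatedWith_iff_poissonForm`). For fixed `x` this is a scalar fact about the functional
`p ↦ c⟨x, p(T')x⟩ - ⟨x, p(T)x⟩`: positivity on polynomials with nonnegative real part is equivalent
to positivity on the Herglotz kernels, which such polynomials approximate; conversely, a Hadamard
product recovers the polynomial from the kernel.

The form becomes explicit at `x = (1 - A) y`, where it equals `‖y‖² - ‖A y‖²`. Put `k = (1 - lT)⁻¹(T
- T')h`. Then `(1 - lT)(h + lk) = (1 - lT')h`, so `k` measures how preimages under the two operators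
differ.

For (i), the domination on the circle `|z| = 1`, tested on `(z - l)⁻¹ (1 - zT')h`, says that the
real part of a function holomorphic near the closed disc is nonnegative. Its value at `0` is the
estimate, with the same constant. For (ii), an isometry turns the form of `zT` into `(1 - |z|²)‖h +
zk‖²`, and the estimate bounds `k`. -/

/-! ### Scalar harmonic analysis: Hadamard products and Herglotz kernels -/

open Finset in
/-- Averaging over the `N`-th roots of unity: the Hadamard product of two sequences whose
polynomials have nonnegative real part on the unit circle. -/
theorem re_sum_mul_nonneg_of_re_nonneg_on_circle (M : ℕ) (hM : 0 < M) (p q : ℕ → ℂ)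
    (hp : ∀ z : ℂ, ‖z‖ = 1 → 0 ≤ (∑ n ∈ range M, p n * z ^ n).re)
    (hq : ∀ z : ℂ, ‖z‖ = 1 → 0 ≤ (∑ n ∈ range M, q n * z ^ n).re) :
    0 ≤ (p 0 * star (q 0) + ∑ n ∈ range M, p n * q n).re := by
  -- With `2 * M` roots no sum `n + m` of two indices below `M` wraps around, so only `n = m = 0`
  -- survives in `h2`.
  set N := 2 * M with hN
  have hN0 : N ≠ 0 := by omega
  set ζ : ℂ := Complex.exp (2 * Real.pi * Complex.I / N)
  have hζ : IsPrimitiveRoot ζ N := Complex.isPrimitiveRoot_exp N hN0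
  have hζ1 : ‖ζ‖ = 1 := hζ.norm'_eq_one hN0
  have hζ0 : ζ ≠ 0 := hζ.ne_zero hN0
  have hstar : star ζ = ζ⁻¹ := by
    rw [Complex.inv_def, Complex.normSq_eq_norm_sq, hζ1]; simp
  have orth : ∀ w : ℂ, w ^ N = 1 → w ≠ 1 → ∑ k ∈ range N, w ^ k = 0 := by
    intro w hw hw1
    rw [geom_sum_eq hw1, hw]; simp
  have h1 : ∀ n ∈ range M, ∀ m ∈ range M,
      ∑ k ∈ range N, (ζ ^ k) ^ n * (ζ⁻¹ ^ k) ^ m = if n = m then (N : ℂ) else 0 := by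
    intro n hn m hm
    rw [mem_range] at hn hm
    have e : ∀ k, (ζ ^ k) ^ n * (ζ⁻¹ ^ k) ^ m = (ζ ^ n * (ζ⁻¹) ^ m) ^ k := by
      intro k; rw [mul_pow]; simp only [← pow_mul]; rw [mul_comm k n, mul_comm k m]
    simp only [e]
    split_ifs with h
    · subst h; rw [inv_pow, mul_inv_cancel₀ (pow_ne_zero _ hζ0)]; simp
    · apply orth
      · rw [mul_pow, pow_right_comm ζ n, pow_right_comm ζ⁻¹ m, inv_pow ζ N, hζ.pow_eq_one]
        simp
      · intro h'
        rw [inv_pow, mul_inv_eq_one₀ (pow_ne_zero _ hζ0)] at h'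
        exact h (hζ.pow_inj (by omega) (by omega) h')
  have h2 : ∀ n ∈ range M, ∀ m ∈ range M,
      ∑ k ∈ range N, (ζ ^ k) ^ n * (ζ ^ k) ^ m = if n + m = 0 then (N : ℂ) else 0 := by
    intro n hn m hm
    rw [mem_range] at hn hm
    have e : ∀ k, (ζ ^ k) ^ n * (ζ ^ k) ^ m = (ζ ^ (n + m)) ^ k := by
      intro k; rw [← pow_add, ← pow_mul, ← pow_mul, mul_comm]
    simp only [e]
    split_ifs with h
    · rw [h]; simp
    · apply orth
      · rw [← pow_mul, mul_comm, pow_mul, hζ.pow_eq_one, one_pow]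
      · exact hζ.pow_ne_one_of_pos_of_lt h (by omega)
  have A1 : ∑ k ∈ range N, (∑ n ∈ range M, p n * (ζ ^ k) ^ n) *
      (∑ m ∈ range M, q m * (ζ⁻¹ ^ k) ^ m) = N * ∑ n ∈ range M, p n * q n := by
    simp only [sum_mul_sum]
    rw [sum_comm, mul_sum]
    refine sum_congr rfl fun n hn => ?_
    rw [sum_comm]
    have : ∀ m ∈ range M, ∑ k ∈ range N, p n * (ζ ^ k) ^ n * (q m * (ζ⁻¹ ^ k) ^ m) =
        if n = m then N * (p n * q n) else 0 := by
      intro m hm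
      have : ∑ k ∈ range N, p n * (ζ ^ k) ^ n * (q m * (ζ⁻¹ ^ k) ^ m) =
          p n * q m * ∑ k ∈ range N, (ζ ^ k) ^ n * (ζ⁻¹ ^ k) ^ m := by
        rw [mul_sum]; exact sum_congr rfl fun _ _ => by ring
      rw [this, h1 n hn m hm]
      split_ifs with h
      · subst h; ring
      · simp
    rw [sum_congr rfl this, sum_ite_eq, if_pos hn]
  have A2 : ∑ k ∈ range N, (∑ n ∈ range M, p n * (ζ ^ k) ^ n) *
      (∑ m ∈ range M, star (q m) * (ζ ^ k) ^ m) = N * (p 0 * star (q 0)) := by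
    simp only [sum_mul_sum]
    rw [sum_comm]
    have : ∀ n ∈ range M, ∀ m ∈ range M,
        ∑ k ∈ range N, p n * (ζ ^ k) ^ n * (star (q m) * (ζ ^ k) ^ m) =
        if n + m = 0 then N * (p 0 * star (q 0)) else 0 := by
      intro n hn m hm
      have : ∑ k ∈ range N, p n * (ζ ^ k) ^ n * (star (q m) * (ζ ^ k) ^ m) =
          p n * star (q m) * ∑ k ∈ range N, (ζ ^ k) ^ n * (ζ ^ k) ^ m := by
        rw [mul_sum]; exact sum_congr rfl fun _ _ => by ring
      rw [this, h2 n hn m hm]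
      split_ifs with h
      · obtain ⟨rfl, rfl⟩ := Nat.add_eq_zero_iff.1 h; ring
      · simp
    rw [sum_eq_single_of_mem 0 (mem_range.2 hM), sum_comm, sum_eq_single_of_mem 0 (mem_range.2 hM)]
    · exact this 0 (mem_range.2 hM) 0 (mem_range.2 hM)
    · intro m hm h0; rw [this 0 (mem_range.2 hM) m hm, if_neg (by omega)]
    · intro n hn h0; rw [sum_comm]
      exact sum_eq_zero fun m hm => by rw [this n hn m hm, if_neg (by omega)]
  -- With `u = p(ζ^k)` and `v = q(ζ^{-k})` the summand is `u (v̄ + v) = 2 u Re v`, whose real part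
  -- is `2 Re u Re v`.
  have key : ∀ k, 0 ≤ ((∑ n ∈ range M, p n * (ζ ^ k) ^ n) *
      (∑ m ∈ range M, star (q m) * (ζ ^ k) ^ m) + (∑ n ∈ range M, p n * (ζ ^ k) ^ n) *
      (∑ m ∈ range M, q m * (ζ⁻¹ ^ k) ^ m)).re := by
    intro k
    have hs : ∑ m ∈ range M, star (q m) * (ζ ^ k) ^ m =
        star (∑ m ∈ range M, q m * (ζ⁻¹ ^ k) ^ m) := by
      rw [star_sum]
      refine sum_congr rfl fun m _ => ?_
      rw [star_mul', star_pow, star_pow, star_inv₀, hstar, inv_inv]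
    rw [hs]
    have a1 := hp (ζ ^ k) (by rw [norm_pow, hζ1, one_pow])
    have a2 := hq (ζ⁻¹ ^ k) (by rw [norm_pow, norm_inv, hζ1]; simp)
    generalize (∑ n ∈ range M, p n * (ζ ^ k) ^ n) = u at *
    generalize (∑ m ∈ range M, q m * (ζ⁻¹ ^ k) ^ m) = v at *
    simp only [Complex.add_re, Complex.mul_re, Complex.star_def, Complex.conj_re, Complex.conj_im]
    nlinarith [mul_nonneg a1 a2]
  have tot := sum_nonneg fun k (_ : k ∈ range N) => key k
  rw [← Complex.re_sum, sum_add_distrib, A1, A2, ← mul_add, ← Complex.ofReal_natCast,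
    Complex.re_ofReal_mul] at tot
  exact nonneg_of_mul_nonneg_right tot (by exact_mod_cast Nat.pos_of_ne_zero hN0)

/-- A function analytic near the closed disc with nonnegative real part on the circle has
nonnegative real part at the center. -/
theorem re_nonneg_zero_of_re_nonneg_on_circle (f : ℂ → ℂ)
    (hf : ∀ z : ℂ, ‖z‖ ≤ 1 → DifferentiableAt ℂ f z) (h : ∀ z : ℂ, ‖z‖ = 1 → 0 ≤ (f z).re) :
    0 ≤ (f 0).re := by
  -- Maximum modulus for `exp (-f)`, whose modulus is `exp (-Re f)`.
  have hd : DiffContOnCl ℂ (fun z => Complex.exp (-f z)) (Metric.ball (0 : ℂ) 1) := by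
    apply DifferentiableOn.diffContOnCl
    rw [closure_ball _ one_ne_zero]
    intro z hz
    exact ((hf z (by simpa using hz)).neg.cexp).differentiableWithinAt
  have := Complex.norm_le_of_forall_mem_frontier_norm_le Metric.isBounded_ball hd (C := 1)
    (by
      intro z hz
      rw [frontier_ball _ one_ne_zero] at hz
      rw [Complex.norm_exp, Complex.neg_re]
      exact Real.exp_le_one_iff.2 (by linarith [h z (by simpa using hz)]))
    (z := 0) (subset_closure (by simp))
  rw [Complex.norm_exp, Complex.neg_re, Real.exp_le_one_iff] at this
  linarith

open Filter Topology Finset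

theorem re_two_mul_inv_one_sub_sub_one (w : ℂ) (hw : 1 - w ≠ 0) :
    (2 * (1 - w)⁻¹ - 1).re = (1 - Complex.normSq w) / Complex.normSq (1 - w) := by
  have h3 : Complex.normSq (1 - w) ≠ 0 := (Complex.normSq_pos.2 hw).ne'
  have e : Complex.normSq (1 - w) = 1 - 2 * w.re + Complex.normSq w := by
    simp [Complex.normSq_apply]; ring
  rw [eq_div_iff h3]
  have : (2 * (1 - w)⁻¹ - 1).re = 2 * ((1 - w.re) / Complex.normSq (1 - w)) - 1 := by
    simp [Complex.inv_re, Complex.mul_re]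
  rw [this, sub_mul, mul_assoc, div_mul_cancel₀ _ h3, e]; ring

theorem re_two_mul_inv_one_sub_sub_one_nonneg (w : ℂ) (hw : ‖w‖ < 1) :
    0 ≤ (2 * (1 - w)⁻¹ - 1).re := by
  have h1 : 1 - w ≠ 0 := by
    intro h; rw [sub_eq_zero] at h; rw [← h] at hw; simp at hw
  have h2 : Complex.normSq w < 1 := by
    rw [Complex.normSq_eq_norm_sq]; exact pow_lt_one₀ (norm_nonneg _) hw two_ne_zero
  rw [re_two_mul_inv_one_sub_sub_one w h1]
  exact div_nonneg (by linarith) (Complex.normSq_nonneg _)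

/-- A functional on polynomials that is positive on polynomials with nonnegative real part is
positive on the Herglotz kernels. -/
theorem herglotz_nonneg_of_polynomial_nonneg (φ : Polynomial ℂ →ₗ[ℂ] ℂ)
    (hφ : ∀ p : Polynomial ℂ, (∀ z : ℂ, ‖z‖ ≤ 1 → 0 ≤ (p.eval z).re) → 0 ≤ (φ p).re)
    (z : ℂ) (hz : ‖z‖ < 1) (S : ℂ) (hS : HasSum (fun n => z ^ n * φ (Polynomial.X ^ n)) S) :
    0 ≤ (2 * S - φ 1).re := by
  -- Bounds the tail of `2 ∑ (z w)^n` uniformly for `‖w‖ ≤ 1`; adding it to the truncated kernel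
  -- keeps the real part nonnegative, and it vanishes in the limit.
  set ε : ℕ → ℝ := fun N => 2 * (‖z‖ ^ N / (1 - ‖z‖))
  have hε : Tendsto (fun N => ((ε N : ℝ) : ℂ)) atTop (𝓝 0) := by
    rw [← Complex.ofReal_zero]
    refine (Complex.continuous_ofReal.tendsto 0).comp ?_
    have := ((tendsto_pow_atTop_nhds_zero_of_lt_one (norm_nonneg z) hz).div_const
      (1 - ‖z‖)).const_mul 2
    simpa [ε] using this
  set P : ℕ → Polynomial ℂ := fun N =>
    (2 : ℂ) • ∑ n ∈ range N, z ^ n • Polynomial.X ^ n + ((ε N : ℂ) - 1) • 1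
  have hlim : Tendsto (fun N => φ (P N)) atTop (𝓝 (2 * S + (0 - 1) * φ 1)) := by
    have e : (fun N => φ (P N)) = fun N =>
        2 * ∑ n ∈ range N, z ^ n * φ (Polynomial.X ^ n) + ((ε N : ℂ) - 1) * φ 1 := by
      funext N; simp [P, map_sum]
    rw [e]
    exact (hS.tendsto_sum_nat.const_mul 2).add ((hε.sub_const 1).mul_const _)
  have hnn : ∀ N, 0 ≤ (φ (P N)).re := by
    intro N
    apply hφ
    intro w hw
    have hzw : ‖z * w‖ ≤ ‖z‖ := by
      rw [norm_mul]; exact mul_le_of_le_one_right (norm_nonneg _) hw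
    have hzw1 : ‖z * w‖ < 1 := hzw.trans_lt hz
    have b := norm_sub_le_of_geometric_bound_of_hasSum (C := 1) hz
      (f := fun n => (z * w) ^ n) (fun n => by
        rw [norm_pow, one_mul]; exact pow_le_pow_left₀ (norm_nonneg _) hzw n)
      (hasSum_geometric_of_norm_lt_one hzw1) N
    have c := (Complex.abs_re_le_norm _).trans b
    have d := re_two_mul_inv_one_sub_sub_one_nonneg _ hzw1
    have e : (P N).eval w = 2 * ∑ n ∈ range N, (z * w) ^ n + ((ε N : ℂ) - 1) := by
      simp [P, Polynomial.eval_finsetSum, mul_pow]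
    rw [e]
    rw [one_mul, Complex.sub_re] at c
    have c' := (abs_le.1 c).1
    simp only [Complex.add_re, Complex.sub_re, Complex.ofReal_re, Complex.one_re, Complex.mul_re,
      Complex.re_ofNat, Complex.im_ofNat, zero_mul, sub_zero] at d c' ⊢
    simp only [ε]
    linarith
  have := ge_of_tendsto' ((Complex.continuous_re.tendsto _).comp hlim) hnn
  simpa [sub_eq_add_neg] using this

/-- The converse of `herglotz_nonneg_of_polynomial_nonneg` for bounded moment sequences. -/
theorem polynomial_nonneg_of_herglotz_nonneg (φ : Polynomial ℂ →ₗ[ℂ] ℂ) (C : ℝ)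
    (hC : ∀ n, ‖φ (Polynomial.X ^ n)‖ ≤ C) (h1 : (φ 1).im = 0)
    (hφ : ∀ z : ℂ, ‖z‖ < 1 → ∃ S, HasSum (fun n => z ^ n * φ (Polynomial.X ^ n)) S ∧
      0 ≤ (2 * S - φ 1).re)
    (p : Polynomial ℂ) (hp : ∀ z : ℂ, ‖z‖ ≤ 1 → 0 ≤ (p.eval z).re) : 0 ≤ (φ p).re := by
  have hC0 : 0 ≤ C := (norm_nonneg _).trans (hC 0)
  set s : ℕ → ℂ := fun n => φ (Polynomial.X ^ n) with hs
  have hs0 : s 0 = φ 1 := by simp [s]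
  have hstar : star (φ 1) = φ 1 := by
    apply Complex.ext <;> simp [h1]
  -- The dilation by `r` makes the kernel series converge uniformly on the unit circle; `r → 1` at
  -- the end.
  have step : ∀ r : ℝ, 0 < r → r < 1 →
      0 ≤ (∑ n ∈ range (p.natDegree + 1), p.coeff n * ((r : ℂ) ^ n * s n)).re := by
    intro r hr0 hr1
    set ε : ℕ → ℝ := fun N => 2 * (C * r ^ N / (1 - r)) with hεdef
    have hε : Tendsto ε atTop (𝓝 0) := by
      have := ((((tendsto_pow_atTop_nhds_zero_of_lt_one hr0.le hr1).const_mul C).div_const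
        (1 - r))).const_mul 2
      simpa [ε] using this
    have key : ∀ M, p.natDegree < M →
        0 ≤ (∑ n ∈ range (p.natDegree + 1), p.coeff n * ((r : ℂ) ^ n * s n)).re
          + (p.coeff 0).re * ε M := by
      intro M hM
      have hM0 : 0 < M := by omega
      -- Coefficients of the truncated dilated kernel, lifted by the tail bound `ε M`.
      set q : ℕ → ℂ := fun n => 2 * ((r : ℂ) ^ n * s n) + if n = 0 then (ε M : ℂ) - φ 1 else 0
      have := re_sum_mul_nonneg_of_re_nonneg_on_circle M hM0 p.coeff q
        (fun z hz => by
          rw [← Polynomial.eval_eq_sum_range' hM]; exact hp z hz.le)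
        (fun z hz => by
          have hrz : ‖(r : ℂ) * z‖ = r := by simp [hz, abs_of_pos hr0]
          obtain ⟨S, hS, hS0⟩ := hφ (r * z) (by rw [hrz]; exact hr1)
          have b := norm_sub_le_of_geometric_bound_of_hasSum (C := C) hr1 (fun n => by
            rw [norm_mul, norm_pow, hrz, mul_comm]
            exact mul_le_mul_of_nonneg_right (hC n) (pow_nonneg hr0.le n)) hS M
          have c' := (abs_le.1 ((Complex.abs_re_le_norm _).trans b)).1
          have e : ∑ n ∈ range M, q n * z ^ n =
              2 * ∑ n ∈ range M, ((r : ℂ) * z) ^ n * φ (Polynomial.X ^ n) + ((ε M : ℂ) - φ 1) := by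
            simp only [q, add_mul, sum_add_distrib, ite_mul, zero_mul]
            rw [sum_ite_eq_of_mem' _ _ _ (mem_range.2 hM0), mul_sum]
            congr 1
            · exact sum_congr rfl fun n _ => by simp only [s, mul_pow]; ring
            · simp
          rw [e]
          simp only [Complex.add_re, Complex.sub_re, Complex.ofReal_re, Complex.mul_re,
            Complex.re_ofNat, Complex.im_ofNat, zero_mul, sub_zero] at hS0 c' ⊢
          simp only [ε]
          linarith)
      have e0 : star (q 0) = φ 1 + (ε M : ℂ) := by
        have : q 0 = φ 1 + (ε M : ℂ) := by simp only [q, hs0]; simp; ring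
        rw [this, star_add, hstar]; simp
      have e : ∑ n ∈ range M, p.coeff n * q n =
          2 * ∑ n ∈ range (p.natDegree + 1), p.coeff n * ((r : ℂ) ^ n * s n)
            + p.coeff 0 * ((ε M : ℂ) - φ 1) := by
        have : ∑ n ∈ range M, p.coeff n * ((r : ℂ) ^ n * s n) =
            ∑ n ∈ range (p.natDegree + 1), p.coeff n * ((r : ℂ) ^ n * s n) := by
          symm
          apply sum_subset (range_subset_range.2 hM)
          intro n _ hn
          rw [Polynomial.coeff_eq_zero_of_natDegree_lt (by simpa using hn), zero_mul]
        rw [← this]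
        simp only [q, mul_add, sum_add_distrib, mul_ite, mul_zero]
        rw [sum_ite_eq_of_mem' _ _ _ (mem_range.2 hM0), mul_sum]
        congr 1
        exact sum_congr rfl fun n _ => by ring
      rw [e0, e] at this
      -- Since `φ 1` is real, the extra term at index `0` cancels the `-φ 1` of the kernel.
      have e3 : p.coeff 0 * (φ 1 + (ε M : ℂ)) + (2 * ∑ n ∈ range (p.natDegree + 1),
          p.coeff n * ((r : ℂ) ^ n * s n) + p.coeff 0 * ((ε M : ℂ) - φ 1)) =
          2 * (∑ n ∈ range (p.natDegree + 1), p.coeff n * ((r : ℂ) ^ n * s n)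
            + p.coeff 0 * (ε M : ℂ)) := by ring
      rw [e3] at this
      simp only [Complex.add_re, Complex.ofReal_re, Complex.mul_re, Complex.ofReal_im,
            Complex.re_ofNat, Complex.im_ofNat, zero_mul, mul_zero, sub_zero] at this ⊢
      linarith
    have hl := (hε.const_mul (p.coeff 0).re).const_add
      (∑ n ∈ range (p.natDegree + 1), p.coeff n * ((r : ℂ) ^ n * s n)).re
    rw [mul_zero, add_zero] at hl
    exact ge_of_tendsto hl (eventually_atTop.2 ⟨p.natDegree + 1, fun M hM => key M hM⟩)
  have hp' : φ p = ∑ n ∈ range (p.natDegree + 1), p.coeff n * s n := by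
    conv_lhs => rw [p.as_sum_range_C_mul_X_pow]
    simp only [map_sum, s, ← Polynomial.smul_eq_C_mul, map_smul, smul_eq_mul]
  have hcont : Continuous fun r : ℝ =>
      (∑ n ∈ range (p.natDegree + 1), p.coeff n * ((r : ℂ) ^ n * s n)).re := by fun_prop
  have hl : Tendsto _ (𝓝[<] (1 : ℝ)) _ := (hcont.tendsto 1).mono_left nhdsWithin_le_nhds
  have := ge_of_tendsto hl (by
    filter_upwards [Ioo_mem_nhdsLT (zero_lt_one (α := ℝ))] with r hr using step r hr.1 hr.2)
  simpa [hp'] using this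

/-! ### Poisson kernels of contractions -/

section

variable {H : Type*} [NormedAddCommGroup H] [InnerProductSpace ℂ H] [CompleteSpace H]

theorem harnackDominatedWith_iff_re_inner (c : ℝ) (T T' : H →L[ℂ] H) :
    HarnackDominatedWith c T T' ↔ ∀ p : Polynomial ℂ, (∀ z : ℂ, ‖z‖ ≤ 1 → 0 ≤ (p.eval z).re) →
      ∀ x : H, (inner ℂ x (Polynomial.aeval T p x)).re ≤
        c * (inner ℂ x (Polynomial.aeval T' p x)).re := by
  have hre : ∀ (A : H →L[ℂ] H) (x : H),
      (inner ℂ ((ℜ A : H →L[ℂ] H) x) x).re = (inner ℂ x (A x)).re := by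
    intro A x
    rw [realPart_apply_coe, ContinuousLinearMap.star_eq_adjoint]
    have h2 : (inner ℂ (A x) x).re = (inner ℂ x (A x)).re :=
      inner_re_symm (𝕜 := ℂ) _ _
    simp only [smul_apply, add_apply, smul_add,
      inner_add_left, inner_smul_left_eq_smul, ContinuousLinearMap.adjoint_inner_left,
      Complex.add_re, Complex.real_smul, Complex.re_ofReal_mul, h2]
    ring
  refine forall₂_congr fun p _ => ?_
  rw [ContinuousLinearMap.le_def, ContinuousLinearMap.isPositive_def']
  have hsa : IsSelfAdjoint (c • (ℜ (Polynomial.aeval T' p) : H →L[ℂ] H) -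
      (ℜ (Polynomial.aeval T p) : H →L[ℂ] H)) :=
    ((IsSelfAdjoint.all c).smul (ℜ (Polynomial.aeval T' p)).2).sub (ℜ (Polynomial.aeval T p)).2
  simp only [hsa, true_and]
  refine forall_congr' fun x => ?_
  rw [ContinuousLinearMap.reApplyInnerSelf_apply, sub_apply,
    smul_apply, inner_sub_left, inner_smul_left_eq_smul]
  simp only [RCLike.re_to_complex, Complex.sub_re, Complex.real_smul, Complex.re_ofReal_mul, hre]
  rw [sub_nonneg]

/-- The quadratic form of the Poisson kernel `Re ((1 + A) (1 - A)⁻¹)`. -/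
noncomputable def poissonForm (A : H →L[ℂ] H) (x : H) : ℝ :=
  (inner ℂ x ((2 : ℂ) • Ring.inverse (1 - A) x - x)).re

theorem inverse_one_sub_apply {A : H →L[ℂ] H} (hA : ‖A‖ < 1) (y : H) :
    Ring.inverse (1 - A) (y - A y) = y := by
  have := Ring.inverse_mul_cancel _ (isUnit_one_sub_of_norm_lt_one hA)
  simpa using congr($this y)

theorem apply_inverse_one_sub {A : H →L[ℂ] H} (hA : ‖A‖ < 1) (y : H) :
    A (Ring.inverse (1 - A) y) = Ring.inverse (1 - A) y - y := by
  have := Ring.mul_inverse_cancel _ (isUnit_one_sub_of_norm_lt_one hA)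
  have : Ring.inverse (1 - A) y - A (Ring.inverse (1 - A) y) = y := by simpa using congr($this y)
  rw [eq_sub_iff_add_eq', ← eq_sub_iff_add_eq]
  exact this.symm

theorem poissonForm_one_sub_apply {A : H →L[ℂ] H} (hA : ‖A‖ < 1) (y : H) :
    poissonForm A (y - A y) = ‖y‖ ^ 2 - ‖A y‖ ^ 2 := by
  rw [poissonForm, inverse_one_sub_apply hA]
  have : (2 : ℂ) • y - (y - A y) = y + A y := by rw [two_smul]; abel
  rw [this, inner_sub_left, inner_add_right, inner_add_right]
  have h2 : (inner ℂ (A y) y).re = (inner ℂ y (A y)).re :=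
    inner_re_symm (𝕜 := ℂ) _ _
  simp only [Complex.add_re, Complex.sub_re, h2, inner_self_eq_norm_sq_to_K,
    Complex.coe_algebraMap, ← Complex.ofReal_pow, Complex.ofReal_re]
  ring

theorem hasSum_inner_pow {T : H →L[ℂ] H} {z : ℂ} (h : ‖z • T‖ < 1) (x : H) :
    HasSum (fun n => z ^ n * inner ℂ x ((T ^ n) x)) (inner ℂ x (Ring.inverse (1 - z • T) x)) := by
  have h1 := hasSum_geom_series_inverse _ h
  have h2 := h1.mapL ((innerSL ℂ x).comp (ContinuousLinearMap.apply ℂ H x))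
  simpa [smul_pow, inner_smul_right] using h2

theorem norm_smul_lt_one {T : H →L[ℂ] H} (hT : ‖T‖ ≤ 1) {z : ℂ} (hz : ‖z‖ < 1) : ‖z • T‖ < 1 := by
  rw [norm_smul]
  exact (mul_le_of_le_one_right (norm_nonneg _) hT).trans_lt hz

/-- The functional `p ↦ c ⟨x, p(T') x⟩ - ⟨x, p(T) x⟩` on polynomials. -/
noncomputable def domFunctional (c : ℝ) (T T' : H →L[ℂ] H) (x : H) : Polynomial ℂ →ₗ[ℂ] ℂ where
  toFun p := c * inner ℂ x (Polynomial.aeval T' p x) - inner ℂ x (Polynomial.aeval T p x)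
  map_add' p q := by simp; ring
  map_smul' a p := by simp; ring

omit [CompleteSpace H] in
theorem domFunctional_apply (c : ℝ) (T T' : H →L[ℂ] H) (x : H) (p : Polynomial ℂ) :
    domFunctional c T T' x p =
      c * inner ℂ x (Polynomial.aeval T' p x) - inner ℂ x (Polynomial.aeval T p x) := rfl

theorem domFunctional_kernel (c : ℝ) {T T' : H →L[ℂ] H} (hT : ‖T‖ ≤ 1) (hT' : ‖T'‖ ≤ 1) (x : H)
    {z : ℂ} (hz : ‖z‖ < 1) :
    ∃ S, HasSum (fun n => z ^ n * domFunctional c T T' x (Polynomial.X ^ n)) S ∧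
      (2 * S - domFunctional c T T' x 1).re =
        c * poissonForm (z • T') x - poissonForm (z • T) x := by
  refine ⟨c * inner ℂ x (Ring.inverse (1 - z • T') x) - inner ℂ x (Ring.inverse (1 - z • T) x),
    ?_, ?_⟩
  · have := ((hasSum_inner_pow (norm_smul_lt_one hT' hz) x).mul_left (c : ℂ)).sub
      (hasSum_inner_pow (norm_smul_lt_one hT hz) x)
    have e : (fun n => z ^ n * domFunctional c T T' x (Polynomial.X ^ n)) = fun n =>
        c * (z ^ n * inner ℂ x ((T' ^ n) x)) - z ^ n * inner ℂ x ((T ^ n) x) := by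
      funext n
      simp only [domFunctional_apply, map_pow, Polynomial.aeval_X]; ring
    rw [e]
    exact this
  · simp only [domFunctional_apply, poissonForm, map_one, one_apply_eq_self,
      inner_sub_right, inner_smul_right, ← Complex.re_ofReal_mul, ← Complex.sub_re]
    congr 1; ring

/-- Harnack domination amounts to domination of the Poisson kernels. -/
theorem harnackDominatedWith_iff_poissonForm (c : ℝ) {T T' : H →L[ℂ] H}
    (hT : ‖T‖ ≤ 1) (hT' : ‖T'‖ ≤ 1) :
    HarnackDominatedWith c T T' ↔ ∀ z : ℂ, ‖z‖ < 1 → ∀ x : H,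
      poissonForm (z • T) x ≤ c * poissonForm (z • T') x := by
  rw [harnackDominatedWith_iff_re_inner]
  have hre : ∀ x p, (domFunctional c T T' x p).re = c * (inner ℂ x (Polynomial.aeval T' p x)).re -
      (inner ℂ x (Polynomial.aeval T p x)).re := fun x p => by
    rw [domFunctional_apply, Complex.sub_re, Complex.re_ofReal_mul]
  constructor
  · intro h z hz x
    obtain ⟨S, hS, hS'⟩ := domFunctional_kernel c hT hT' x hz
    have := herglotz_nonneg_of_polynomial_nonneg (domFunctional c T T' x)
      (fun p hp => by rw [hre, sub_nonneg]; exact h p hp x) z hz S hS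
    rwa [hS', sub_nonneg] at this
  · intro h p hp x
    have bound : ∀ {A : H →L[ℂ] H}, ‖A‖ ≤ 1 → ∀ n : ℕ,
        ‖inner ℂ x ((A ^ n) x)‖ ≤ ‖x‖ * ‖x‖ := by
      intro A hA n
      refine (norm_inner_le_norm _ _).trans (mul_le_mul_of_nonneg_left ?_ (norm_nonneg _))
      induction n with
      | zero => simp
      | succ n ih =>
        rw [pow_succ', mul_apply_eq_comp]
        exact (A.le_of_opNorm_le hA _).trans (by rwa [one_mul])
    have := polynomial_nonneg_of_herglotz_nonneg (domFunctional c T T' x)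
      (|c| * (‖x‖ * ‖x‖) + ‖x‖ * ‖x‖)
      (fun n => by
        rw [domFunctional_apply]
        simp only [map_pow, Polynomial.aeval_X]
        refine (norm_sub_le _ _).trans (add_le_add ?_ (bound hT n))
        rw [norm_mul, Complex.norm_real, Real.norm_eq_abs]
        exact mul_le_mul_of_nonneg_left (bound hT' n) (abs_nonneg c))
      (by
        simp only [domFunctional_apply, map_one, one_apply_eq_self,
          inner_self_eq_norm_sq_to_K, Complex.coe_algebraMap]
        norm_cast)
      (fun z hz => by
        obtain ⟨S, hS, hS'⟩ := domFunctional_kernel c hT hT' x hz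
        exact ⟨S, hS, by rw [hS', sub_nonneg]; exact h z hz x⟩) p hp
    rwa [hre, sub_nonneg] at this

/-! ### From domination to the resolvent estimate -/

theorem norm_defectOperator_apply_sq {T : H →L[ℂ] H} (hT : ‖T‖ ≤ 1) (h : H) :
    ‖defectOperator T h‖ ^ 2 = ‖h‖ ^ 2 - ‖T h‖ ^ 2 := by
  have hin : ∀ x, (inner ℂ x ((1 - ContinuousLinearMap.adjoint T * T) x)) =
      ((‖x‖ ^ 2 - ‖T x‖ ^ 2 : ℝ) : ℂ) := by
    intro x
    simp [ContinuousLinearMap.adjoint_inner_right]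
  have hpos : (0 : H →L[ℂ] H) ≤ 1 - ContinuousLinearMap.adjoint T * T := by
    rw [ContinuousLinearMap.nonneg_iff_isPositive, ContinuousLinearMap.isPositive_def']
    refine ⟨(IsSelfAdjoint.one _).sub (IsSelfAdjoint.star_mul_self T), fun x => ?_⟩
    rw [ContinuousLinearMap.reApplyInnerSelf_apply, ← inner_conj_symm, hin]
    have := T.le_of_opNorm_le hT x
    rw [one_mul] at this
    rw [RCLike.re_to_complex, Complex.conj_re, Complex.ofReal_re, sub_nonneg]
    exact pow_le_pow_left₀ (norm_nonneg _) this 2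
  have hsa : IsSelfAdjoint (defectOperator T) := (CFC.sqrt_nonneg _).isSelfAdjoint
  have hsq : defectOperator T * defectOperator T = 1 - ContinuousLinearMap.adjoint T * T :=
    CFC.sqrt_mul_sqrt_self _ hpos
  have e : inner ℂ (defectOperator T h) (defectOperator T h) =
      inner ℂ h ((defectOperator T * defectOperator T) h) := by
    nth_rw 1 [← hsa.adjoint_eq]
    rw [ContinuousLinearMap.adjoint_inner_left]
    rfl
  rw [hsq, hin] at e
  rw [← inner_self_eq_norm_sq (𝕜 := ℂ) (defectOperator T h), e]
  exact Complex.ofReal_re _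

/-- Expand `‖y + w‖² - ‖A(y + w)‖²` and drop `‖y‖² - ‖A y‖² ≥ 0`. With `y = (z - l)⁻¹ e` below, what
remains is the real part of a holomorphic function of `z` on the circle. -/
theorem poissonForm_add_le {A : H →L[ℂ] H} (hA : ‖A‖ < 1) (y w : H) :
    (‖w‖ ^ 2 - ‖A w‖ ^ 2) + 2 * (inner ℂ y w - inner ℂ (A y) (A w)).re ≤
      poissonForm A ((y + w) - A (y + w)) := by
  rw [poissonForm_one_sub_apply hA, map_add, @norm_add_sq ℂ, @norm_add_sq ℂ, Complex.sub_re]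
  have := A.le_of_opNorm_le hA.le y
  rw [one_mul] at this
  have := pow_le_pow_left₀ (norm_nonneg _) this 2
  simp only [RCLike.re_to_complex]
  linarith

theorem differentiableAt_inverse_one_sub_smul {T : H →L[ℂ] H} (hT : ‖T‖ < 1) {z : ℂ}
    (hz : ‖z‖ ≤ 1) : DifferentiableAt ℂ (fun z : ℂ => Ring.inverse (1 - z • T)) z := by
  have h : ‖z • T‖ < 1 := by
    rw [norm_smul]; exact (mul_le_of_le_one_left (norm_nonneg _) hz).trans_lt hT
  exact DifferentiableAt.comp (f := fun z : ℂ => 1 - z • T) z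
    (differentiableAt_inverse (𝕜 := ℂ) (isUnit_one_sub_of_norm_lt_one h)) (by fun_prop)

theorem resolvent_bound_of_poissonForm_circle {a : ℝ} {T T' : H →L[ℂ] H} (hT : ‖T‖ < 1)
    (hT' : ‖T'‖ < 1)
    (hdom : ∀ z : ℂ, ‖z‖ = 1 → ∀ x, poissonForm (z • T) x ≤ a * poissonForm (z • T') x)
    (h : H) {l : ℂ} (hl : ‖l‖ < 1) :
    ‖Ring.inverse (1 - l • T) ((T - T') h)‖ ^ 2 ≤
      a / (1 - ‖l‖ ^ 2) * (‖h‖ ^ 2 - ‖T' h‖ ^ 2) := by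
  set k := Ring.inverse (1 - l • T) ((T - T') h) with hk
  set E : ℝ := ‖h‖ ^ 2 - ‖T' h‖ ^ 2
  set e : H := h + l • k with he
  have hlT := norm_smul_lt_one hT.le hl
  have hTk : l • T k = k - (T h - T' h) :=
    apply_inverse_one_sub hlT ((T - T') h)
  have hTe : T e = k + T' h := by
    rw [he, map_add, map_smul, hTk]; abel
  have hl2 : 0 < 1 - ‖l‖ ^ 2 := by
    have := pow_lt_one₀ (norm_nonneg l) hl two_ne_zero; linarith
  have hne : ∀ z : ℂ, ‖z‖ ≤ 1 → 1 - star l * z ≠ 0 := by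
    intro z hz h0
    rw [sub_eq_zero] at h0
    have h1 := congrArg norm h0
    rw [norm_one, norm_mul, norm_star] at h1
    nlinarith [mul_le_of_le_one_right (norm_nonneg l) hz]
  set R : ℂ → H →L[ℂ] H := fun z => Ring.inverse (1 - z • T) with hR
  -- Holomorphic extension of the difference of the two sides of the domination inequality. On `|z|
  -- = 1`, the conjugate of `(z - l)⁻¹` is `z / (1 - l̄ z)`, and `(1 - |l|²)|z - l|⁻²` is the real
  -- part of `(1 + l̄ z) / (1 - l̄ z)`. At `z = 0` the cross term vanishes.
  set f : ℂ → ℂ := fun z =>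
    ((a * E / (1 - ‖l‖ ^ 2) : ℝ) : ℂ) * ((1 + star l * z) / (1 - star l * z)) -
      inner ℂ k ((2 : ℂ) • R z k - k) -
      2 * (z / (1 - star l * z)) * (inner ℂ e (R z k) - inner ℂ (T e) (T (R z k))) with hf
  have hfd : ∀ z : ℂ, ‖z‖ ≤ 1 → DifferentiableAt ℂ f z := by
    intro z hz
    have hRd : DifferentiableAt ℂ (fun z => R z k) z :=
      (differentiableAt_inverse_one_sub_smul hT hz).clm_apply (differentiableAt_const k)
    have hin : ∀ {g : ℂ → H} (v : H), DifferentiableAt ℂ g z →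
        DifferentiableAt ℂ (fun z => inner ℂ v (g z)) z := fun v hg =>
      (innerSL ℂ v).differentiableAt.comp z hg
    have hd : DifferentiableAt ℂ (fun z => 1 - star l * z) z := by fun_prop
    refine DifferentiableAt.sub (DifferentiableAt.sub ?_ (hin k ?_)) (DifferentiableAt.mul ?_
      (DifferentiableAt.sub (hin e hRd) (hin (T e) (T.differentiableAt.comp z hRd))))
    · exact DifferentiableAt.const_mul (DifferentiableAt.div (by fun_prop) hd (hne z hz)) _
    · exact (hRd.const_smul _).sub_const _
    · exact DifferentiableAt.const_mul (DifferentiableAt.div (by fun_prop) hd (hne z hz)) _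
  have hf0 : (f 0).re = a * E / (1 - ‖l‖ ^ 2) - ‖k‖ ^ 2 := by
    have : f 0 = ((a * E / (1 - ‖l‖ ^ 2) - ‖k‖ ^ 2 : ℝ) : ℂ) := by
      simp only [hf, hR, zero_smul, sub_zero, Ring.inverse_one, one_apply_eq_self, two_smul,
        add_sub_cancel_right, mul_zero, zero_mul, add_zero, div_one, mul_one,
        inner_self_eq_norm_sq_to_K, Complex.coe_algebraMap]
      push_cast; ring
    rw [this, Complex.ofReal_re]
  have hcirc : ∀ z : ℂ, ‖z‖ = 1 → 0 ≤ (f z).re := by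
    intro z hz
    have hzT : ‖z • T‖ < 1 := by rw [norm_smul, hz, one_mul]; exact hT
    have hzT' : ‖z • T'‖ < 1 := by rw [norm_smul, hz, one_mul]; exact hT'
    have hzz : star z * z = 1 := by
      rw [Complex.star_def, Complex.conj_mul', hz]; simp
    have hzl : z - l ≠ 0 := by
      intro h0; rw [sub_eq_zero] at h0; rw [h0] at hz; linarith
    set g : ℂ := (z - l)⁻¹ with hg
    have hsg : star g = z / (1 - star l * z) := by
      rw [hg, star_inv₀, star_sub, eq_div_iff (hne z hz.le), inv_mul_eq_iff_eq_mul₀]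
      · rw [sub_mul, hzz]
      · rw [← star_sub]; exact star_ne_zero.2 hzl
    set w := R z k with hw
    have hzw : z • T w = w - k := apply_inverse_one_sub hzT k
    -- As `e - zTe = (h - zT'h) - (z - l)k`, the factor `g = (z - l)⁻¹` leaves an error `-k`, which
    -- `w = (1 - zT)⁻¹k` cancels.
    have hx : (g • e + w) - (z • T) (g • e + w) = g • h - (z • T') (g • h) := by
      have hA : (z • T) (g • e + w) = g • z • (k + T' h) + (w - k) := by
        rw [map_add, smul_apply, smul_apply, hzw, map_smul, hTe, smul_comm]
      have e1 : g • z • k = g • l • k + k := by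
        rw [← sub_eq_iff_eq_add', ← smul_sub, ← sub_smul, smul_smul, hg, inv_mul_cancel₀ hzl,
          one_smul]
      rw [hA, he, smul_apply, map_smul, smul_add, smul_add, smul_add, e1, smul_comm z g]
      abel
    have h1 := poissonForm_add_le hzT (g • e) w
    rw [hx] at h1
    have h2 := h1.trans (hdom z hz _)
    rw [poissonForm_one_sub_apply hzT'] at h2
    have hk2 : (inner ℂ k ((2 : ℂ) • w - k)).re = ‖w‖ ^ 2 - ‖(z • T) w‖ ^ 2 := by
      have := poissonForm_one_sub_apply hzT w
      rw [show w - (z • T) w = k by rw [smul_apply, hzw]; abel] at this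
      exact this
    have hcross : inner ℂ (g • e) w - inner ℂ ((z • T) (g • e)) ((z • T) w) =
        star g * (inner ℂ e w - inner ℂ (T e) (T w)) := by
      simp only [smul_apply, map_smul, inner_smul_left, inner_smul_right, ← Complex.star_def]
      linear_combination (-(star g * inner ℂ (T e) (T w))) * hzz
    have hn : ‖g • h‖ ^ 2 - ‖(z • T') (g • h)‖ ^ 2 = ‖g‖ ^ 2 * E := by
      rw [smul_apply, map_smul, norm_smul, norm_smul, norm_smul, hz]
      ring
    have hre : ((1 + star l * z) / (1 - star l * z)).re = (1 - ‖l‖ ^ 2) * ‖g‖ ^ 2 := by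
      have hd := hne z hz.le
      have e1 : (1 + star l * z) / (1 - star l * z) = 2 * (1 - star l * z)⁻¹ - 1 := by
        field_simp; ring
      have hgn : ‖g‖ ^ 2 = (Complex.normSq (1 - star l * z))⁻¹ := by
        rw [← norm_star, hsg, norm_div, hz, Complex.normSq_eq_norm_sq]; simp
      have hln : Complex.normSq (star l * z) = ‖l‖ ^ 2 := by
        rw [Complex.normSq_eq_norm_sq, norm_mul, norm_star, hz, mul_one]
      rw [e1, hgn, re_two_mul_inv_one_sub_sub_one _ hd, hln, div_eq_mul_inv]
    rw [hcross, hn, hsg, ← hk2] at h2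
    simp only [hf, Complex.sub_re, Complex.re_ofReal_mul, hre]
    rw [mul_assoc (2 : ℂ)]
    have e2 : ∀ u : ℂ, (2 * u).re = 2 * u.re := fun u => by simp
    rw [e2]
    have e3 : a * E / (1 - ‖l‖ ^ 2) * ((1 - ‖l‖ ^ 2) * ‖g‖ ^ 2) = a * (‖g‖ ^ 2 * E) := by
      field_simp
    rw [e3]
    linarith
  have := re_nonneg_zero_of_re_nonneg_on_circle f hfd hcirc
  rw [hf0] at this
  rw [div_mul_eq_mul_div]
  linarith

theorem resolventEstimate_of_harnackDominatedWith {a : ℝ} {T T' : H →L[ℂ] H} (hT : ‖T‖ ≤ 1)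
    (hT' : ‖T'‖ ≤ 1) (hdom : HarnackDominatedWith a T T') : ResolventEstimate a T T' := by
  rw [harnackDominatedWith_iff_poissonForm a hT hT'] at hdom
  intro h l hl
  rw [norm_defectOperator_apply_sq hT']
  -- Passing to `rT`, `rT'` gives strict contractions, whose kernels are defined on the unit circle.
  have step : ∀ r : ℝ, 0 < r → r < 1 →
      ‖Ring.inverse (1 - l • (r : ℂ) • T) (((r : ℂ) • T - (r : ℂ) • T') h)‖ ^ 2 ≤
        a / (1 - ‖l‖ ^ 2) * (‖h‖ ^ 2 - ‖((r : ℂ) • T') h‖ ^ 2) := by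
    intro r hr0 hr1
    have hr : ‖(r : ℂ)‖ < 1 := by simpa [abs_of_pos hr0] using hr1
    refine resolvent_bound_of_poissonForm_circle (norm_smul_lt_one hT hr) (norm_smul_lt_one hT' hr)
      (fun z hz x => ?_) h hl
    rw [smul_smul, smul_smul]
    exact hdom _ (by rw [norm_mul, hz, one_mul]; exact hr) x
  have hu : IsUnit (1 - l • T) := isUnit_one_sub_of_norm_lt_one (norm_smul_lt_one hT hl)
  have hc1 : ContinuousAt (fun r : ℝ => Ring.inverse (1 - l • (r : ℂ) • T)) 1 := by
    obtain ⟨u, hu⟩ := hu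
    have h0 : ContinuousAt (Ring.inverse : (H →L[ℂ] H) → _) (1 - l • ((1 : ℝ) : ℂ) • T) := by
      rw [Complex.ofReal_one, one_smul, ← hu]; exact NormedRing.inverse_continuousAt u
    exact ContinuousAt.comp (f := fun r : ℝ => 1 - l • (r : ℂ) • T) h0 (by fun_prop)
  have hL : ContinuousAt (fun r : ℝ =>
      ‖Ring.inverse (1 - l • (r : ℂ) • T) (((r : ℂ) • T - (r : ℂ) • T') h)‖ ^ 2) 1 :=
    ((hc1.clm_apply (by fun_prop)).norm).pow 2
  have hRc : ContinuousAt (fun r : ℝ =>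
      a / (1 - ‖l‖ ^ 2) * (‖h‖ ^ 2 - ‖((r : ℂ) • T') h‖ ^ 2)) 1 := by fun_prop
  have := le_of_tendsto_of_tendsto (hL.tendsto.mono_left nhdsWithin_le_nhds)
    (hRc.tendsto.mono_left nhdsWithin_le_nhds) (b := 𝓝[<] (1 : ℝ)) (by
      filter_upwards [Ioo_mem_nhdsLT (zero_lt_one (α := ℝ))] with r hr using step r hr.1 hr.2)
  simpa using this

/-! ### The converse for isometries -/

theorem harnackDominatedWith_of_resolventEstimate {c : ℝ} {T T' : H →L[ℂ] H}
    (hT : ‖T‖ ≤ 1) (hT' : ‖T'‖ ≤ 1) (hiso : Isometry T) (hc : ResolventEstimate c T T') :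
    HarnackDominatedWith (max 2 (2 * c)) T T' := by
  rw [harnackDominatedWith_iff_poissonForm _ hT hT']
  intro z hz x
  have hzT := norm_smul_lt_one hT hz
  have hzT' := norm_smul_lt_one hT' hz
  set h := Ring.inverse (1 - z • T') x
  have hx : x = h - (z • T') h := by rw [apply_inverse_one_sub hzT', sub_sub_cancel]
  set k := Ring.inverse (1 - z • T) ((T - T') h) with hk
  have hTk : z • T k = k - (T h - T' h) :=
    apply_inverse_one_sub hzT ((T - T') h)
  have hxy : x = (h + z • k) - (z • T) (h + z • k) := by
    rw [hx]
    simp only [smul_apply, map_add, map_smul, hTk, smul_sub]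
    abel
  have e1 : poissonForm (z • T) x = (1 - ‖z‖ ^ 2) * ‖h + z • k‖ ^ 2 := by
    have hn : ‖T (h + z • k)‖ = ‖h + z • k‖ :=
      (AddMonoidHomClass.isometry_iff_norm T).1 hiso _
    rw [hxy, poissonForm_one_sub_apply hzT, smul_apply, norm_smul, hn]
    ring
  have e2 : poissonForm (z • T') x = ‖h‖ ^ 2 - ‖z‖ ^ 2 * ‖T' h‖ ^ 2 := by
    rw [hx, poissonForm_one_sub_apply hzT', smul_apply, norm_smul]
    ring
  have hk2 := hc h z hz
  rw [← hk, norm_defectOperator_apply_sq hT'] at hk2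
  rw [e1, e2]
  have hz2 : 0 < 1 - ‖z‖ ^ 2 := by
    have := pow_lt_one₀ (norm_nonneg z) hz two_ne_zero; linarith
  rw [div_mul_eq_mul_div, le_div_iff₀ hz2] at hk2
  have hD : 0 ≤ ‖h‖ ^ 2 - ‖T' h‖ ^ 2 := by
    rw [← norm_defectOperator_apply_sq hT']; positivity
  have hy : ‖h + z • k‖ ^ 2 ≤ 2 * (‖h‖ ^ 2 + ‖z‖ ^ 2 * ‖k‖ ^ 2) := by
    have := norm_add_le h (z • k)
    rw [norm_smul] at this
    refine (pow_le_pow_left₀ (norm_nonneg _) this 2).trans ?_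
    nlinarith [sq_nonneg (‖h‖ - ‖z‖ * ‖k‖)]
  set m := max 2 (2 * c)
  have hm1 : 2 ≤ m := le_max_left _ _
  have hm2 : 2 * c ≤ m := le_max_right _ _
  -- The target splits as `‖h‖² - |z|²‖T'h‖² = (1 - |z|²)‖h‖² + |z|²(‖h‖² - ‖T'h‖²)`. The first term
  -- needs the factor `2`, the second `2c`, hence the maximum.
  calc (1 - ‖z‖ ^ 2) * ‖h + z • k‖ ^ 2
      ≤ (1 - ‖z‖ ^ 2) * (2 * (‖h‖ ^ 2 + ‖z‖ ^ 2 * ‖k‖ ^ 2)) :=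
        mul_le_mul_of_nonneg_left hy hz2.le
    _ = 2 * ((1 - ‖z‖ ^ 2) * ‖h‖ ^ 2) + 2 * ‖z‖ ^ 2 * (‖k‖ ^ 2 * (1 - ‖z‖ ^ 2)) := by ring
    _ ≤ 2 * ((1 - ‖z‖ ^ 2) * ‖h‖ ^ 2) + 2 * ‖z‖ ^ 2 * (c * (‖h‖ ^ 2 - ‖T' h‖ ^ 2)) := by gcongr
    _ = 2 * ((1 - ‖z‖ ^ 2) * ‖h‖ ^ 2) + 2 * c * (‖z‖ ^ 2 * (‖h‖ ^ 2 - ‖T' h‖ ^ 2)) := by ring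
    _ ≤ m * ((1 - ‖z‖ ^ 2) * ‖h‖ ^ 2) + m * (‖z‖ ^ 2 * (‖h‖ ^ 2 - ‖T' h‖ ^ 2)) := by gcongr
    _ = m * (‖h‖ ^ 2 - ‖z‖ ^ 2 * ‖T' h‖ ^ 2) := by ring

end

theorem mainTheorem3 {H : Type*} [NormedAddCommGroup H] [InnerProductSpace ℂ H] [CompleteSpace H]
    (T T' : H →L[ℂ] H) (hT : ‖T‖ ≤ 1) (hT' : ‖T'‖ ≤ 1) :
    (HarnackDominated T T' → ∃ c : ℝ, 0 < c ∧ ResolventEstimate c T T') ∧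
    (Isometry T → (∃ c : ℝ, 0 < c ∧ ResolventEstimate c T T') → HarnackDominated T T') := by
  constructor
  · rintro ⟨c, hc, h⟩
    exact ⟨c, zero_lt_one.trans_le hc, resolventEstimate_of_harnackDominatedWith hT hT' h⟩
  · rintro hiso ⟨c, -, h⟩
    exact ⟨max 2 (2 * c), one_le_two.trans (le_max_left _ _),
      harnackDominatedWith_of_resolventEstimate hT hT' hiso h⟩
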